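/- \textbf{Definitions.} A processor with input alphabet $A$, output alphabet $B$ and state space $Q$ consists of maps $t_i:Q\to Q$ and $o_i:Q\to\mathbb N^B$ for $i\in A$: on receiving the letter $i$ in state $q$ it moves to state $t_i(q)$ and emits $o_i(q)_b$ letters $b$ for each $b\in B$. It is abelian if $t_it_j=t_jt_i$ and $o_i+o_j\circ t_i=o_j+o_i\circ t_j$ for all $i,j\in A$, and finite if $A,B,Q$ are finite. It comes with an initial state from which every state can be reached by some sequence of input letters. It computes $F:\mathbb N^A\to\mathbb N^B$ if, from the initial state, inputting $x_a$ letters $a$ for each $a\in A$ (in any order) results in the output of $F(x)_b$ letters $b$ for each $b\in B$. A finite abelian network with inputs $A$ and outputs $B$ is a finite directed multigraph with pairwise disjoint sets of dangling edges: input edges (labelled by $A$; exactly the edges without a tail), and output edges (labelled by $B$) and trash edges (together exactly the edges without a head). At each node there is a finite abelian processor whose input alphabet is the set of incoming edges and whose output alphabet is the set of outgoing edges. Initially every processor is in its initial state and $x_a$ letters are on the input edge $a$. At each step one letter waiting on an edge with a head is fed into the processor at the head, which changes state and puts letters on its outgoing edges accordingly. An execution halts when all letters are on output and trash edges. The network computes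 $F:\mathbb N^A\to\mathbb N^B$ if for every $x\in\mathbb N^A$ every legal execution halts, with $F(x)_b$ letters on the output edge $b$ for each $b\in B$. A network emulates a processor if both compute the same function. The gates are the following processors. The adder has two inputs, one output and one state, and emits one letter for each letter received. The splitter has one input, two outputs and one state, and emits one letter on each output for each letter received. The others have one input and one output. The $\lambda$-toppler ($\lambda\ge2$) has states $0,\dots,\lambda-1$; a letter received in state $q<\lambda-1$ moves it to $q+1$ with no output, and a letter received in state $\lambda-1$ moves it to $0$ and one letter is emitted; its initial state may be any of its states (it is primed if that state is not $0$). The delayer has states $0$ (initial) and $1$; the first letter moves it to $1$ with no output, and in state $1$ it stays there and emits one letter for each letter received. The presink has states $0$ (initial) and $1$; the first letter moves it to $1$ and one letter is emitted, and in state $1$ it stays there and emits nothing. \textbf{Theorem.} Every finite abelian processor with at least one input letter can be emulated by a finite, directed acyclic (i.e. without directed cycles) network of adders, splitters, (possibly primed) topplers, delayers and presinks. -/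

import Mathlib

/-- A processor with input alphabet `A`, output alphabet `B` and state space `Q`: on receiving the
letter `i` in state `q` it moves to `trans i q` and emits `out i q b` letters `b`, for each `b`. -/
structure Processor (A B Q : Type*) where
  trans : A → Q → Q
  out : A → Q → B → ℕ

namespace Processor

/-- The state reached from `q` after reading the word `w`. -/
def transWord {A B Q : Type*} (P : Processor A B Q) : List A → Q → Q
  | [], q => q
  | i :: w, q => P.transWord w (P.trans i q)

/-- The total output emitted while reading the word `w` from state `q`. -/
def outWord {A B Q : Type*} (P : Processor A B Q) : List A → Q → B → ℕ
  | [], _ => 0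
  | i :: w, q => P.out i q + P.outWord w (P.trans i q)

end Processor

/-- An abelian processor, with a distinguished initial state that can access all states. -/
structure AbelianProcessor (A B Q : Type*) extends Processor A B Q where
  start : Q
  trans_comm : ∀ i j q, trans i (trans j q) = trans j (trans i q)
  out_comm : ∀ i j q, out i q + out j (trans i q) = out j q + out i (trans j q)
  accessible : ∀ q, ∃ w : List A, toProcessor.transWord w start = q

namespace AbelianProcessor

open Classical in
/-- `P` computes `F` if, from the initial state, inputting `x a` letters `a` for each `a` (in any
order) results in the output of `F x b` letters `b` for each `b`. -/
def Computes {A B Q : Type*} (P : AbelianProcessor A B Q) (F : (A → ℕ) → B → ℕ) : Prop :=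
  ∀ w : List A, P.outWord w P.start = F (fun a => w.count a)

/-- Two abelian processors are the same up to renaming the letters and the states. -/
def Isomorphic {A B Q A' B' Q' : Type*} (P : AbelianProcessor A B Q)
    (P' : AbelianProcessor A' B' Q') : Prop :=
  ∃ (α : A ≃ A') (β : B ≃ B') (σ : Q ≃ Q'),
    σ P.start = P'.start ∧
    ∀ a q, σ (P.trans a q) = P'.trans (α a) (σ q) ∧
      ∀ b, P.out a q b = P'.out (α a) (σ q) (β b)

end AbelianProcessor

/-! The abelian logic gates. -/

namespace Gate

/-- The adder has two inputs, one output and one state; it emits one letter for each letter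
received on either input. -/
def adder : AbelianProcessor (Fin 2) Unit Unit where
  trans := fun _ q => q
  out := fun _ _ _ => 1
  start := ()
  trans_comm := fun _ _ _ => rfl
  out_comm := fun _ _ _ => rfl
  accessible := fun _ => ⟨[], rfl⟩

/-- The splitter has one input, two outputs and one state; for each letter received it emits one
letter on each output. -/
def splitter : AbelianProcessor Unit (Fin 2) Unit where
  trans := fun _ q => q
  out := fun _ _ _ => 1
  start := ()
  trans_comm := fun _ _ _ => rfl
  out_comm := fun _ _ _ => rfl
  accessible := fun _ => ⟨[], rfl⟩

/-- The transition map of the `n`-toppler: count up modulo `n`. -/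
def topplerNext (n : ℕ) (q : Fin n) : Fin n :=
  ⟨(q.val + 1) % n, Nat.mod_lt _ (Nat.zero_lt_of_lt q.isLt)⟩

/-- The processor underlying the `n`-toppler: it emits one letter exactly when it moves from the
last state `n - 1` to the state `0`. -/
def topplerProcessor (n : ℕ) : Processor Unit Unit (Fin n) where
  trans := fun _ q => topplerNext n q
  out := fun _ q _ => if q.val + 1 = n then 1 else 0

theorem topplerProcessor_transWord (n : ℕ) (m : ℕ) (q : Fin n) :
    ((topplerProcessor n).transWord (List.replicate m ()) q).val = (q.val + m) % n := by
  induction m generalizing q with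
  | zero => simp [Processor.transWord, Nat.mod_eq_of_lt q.isLt]
  | succ m ih =>
    rw [List.replicate_succ, Processor.transWord, ih]
    simp only [topplerProcessor, topplerNext, Nat.mod_add_mod]
    congr 1
    ring

/-- The `n`-toppler (`n ≥ 2`) with initial state `q`; it is primed if `q` is not zero. -/
def toppler (n : ℕ) (_hn : 2 ≤ n) (q : Fin n) : AbelianProcessor Unit Unit (Fin n) where
  toProcessor := topplerProcessor n
  start := q
  trans_comm := fun _ _ _ => rfl
  out_comm := fun _ _ _ => rfl
  accessible := fun r => ⟨List.replicate (n - q.val + r.val) (), by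
    apply Fin.ext
    rw [topplerProcessor_transWord]
    have hq := q.isLt
    have h : q.val + (n - q.val + r.val) = r.val + n := by omega
    rw [h, Nat.add_mod_right, Nat.mod_eq_of_lt r.isLt]⟩

/-- The delayer has states `false` (initial) and `true`. The first letter moves it permanently to
`true` and nothing is emitted; in state `true` it emits one letter for each letter received. -/
def delayer : AbelianProcessor Unit Unit Bool where
  trans := fun _ _ => true
  out := fun _ q _ => if q then 1 else 0
  start := false
  trans_comm := fun _ _ _ => rfl
  out_comm := fun _ _ _ => rfl
  accessible := fun q => by
    cases q
    · exact ⟨[], rfl⟩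
    · exact ⟨[()], rfl⟩

/-- The presink has states `false` (initial) and `true`. The first letter moves it permanently to
`true` and one letter is emitted; in state `true` all letters are ignored. -/
def presink : AbelianProcessor Unit Unit Bool where
  trans := fun _ _ => true
  out := fun _ q _ => if q then 0 else 1
  start := false
  trans_comm := fun _ _ _ => rfl
  out_comm := fun _ _ _ => rfl
  accessible := fun q => by
    cases q
    · exact ⟨[], rfl⟩
    · exact ⟨[()], rfl⟩

end Gate

/-- `P` is, up to renaming letters and states, an adder, a splitter, a (possibly primed) toppler,
a delayer or a presink. -/
def AbelianProcessor.IsLogicGate {A B Q : Type*} (P : AbelianProcessor A B Q) : Prop :=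
  P.Isomorphic Gate.adder ∨ P.Isomorphic Gate.splitter ∨
    (∃ (n : ℕ) (hn : 2 ≤ n) (q : Fin n), P.Isomorphic (Gate.toppler n hn q)) ∨
    P.Isomorphic Gate.delayer ∨ P.Isomorphic Gate.presink

/-- A finite abelian network whose input wires are labelled by `A` and whose output wires are
labelled by `B`: a finite directed multigraph with dangling input, output and trash edges, and a
finite abelian processor at each node whose input (output) alphabet is the set of incoming
(outgoing) edges of the node. The input edges are those without a tail; the output and trash edges
are those without a head. -/
structure AbelianNetwork (A B : Type*) where
  V : Type
  E : Type
  finite_V : Finite V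
  finite_E : Finite E
  tail : E → Option V
  head : E → Option V
  input : A ↪ E
  output : B ↪ E
  trash : Set E
  disjoint_input_output : Disjoint (Set.range input) (Set.range output)
  disjoint_input_trash : Disjoint (Set.range input) trash
  disjoint_output_trash : Disjoint (Set.range output) trash
  tail_eq_none_iff : ∀ e, tail e = none ↔ e ∈ Set.range input
  head_eq_none_iff : ∀ e, head e = none ↔ e ∈ Set.range output ∪ trash
  State : V → Type
  finite_State : ∀ v, Finite (State v)
  proc : ∀ v, AbelianProcessor {e : E // head e = some v} {e : E // tail e = some v} (State v)

namespace AbelianNetwork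

/-- There is an edge from `u` to `v`. -/
def Adj {A B : Type*} (N : AbelianNetwork A B) (u v : N.V) : Prop :=
  ∃ e, N.tail e = some u ∧ N.head e = some v

/-- The underlying multigraph has no directed cycle. -/
def DirectedAcyclic {A B : Type*} (N : AbelianNetwork A B) : Prop :=
  ∀ v, ¬ Relation.TransGen N.Adj v v

/-- The total state of a network: the internal states of all its processors and the number of
letters sitting on each edge. -/
structure Config {A B : Type*} (N : AbelianNetwork A B) where
  state : ∀ v, N.State v
  letters : N.E → ℕ

/-- The initial total state: all processors are in their initial states, `x a` letters sit on the
input edge labelled `a`, and there are no other letters. -/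
noncomputable def init {A B : Type*} (N : AbelianNetwork A B) (x : A → ℕ) : N.Config where
  state := fun v => (N.proc v).start
  letters := Function.extend N.input x 0

open Classical in
/-- The total state after one letter on the edge `e` is fed into the processor at its head `v`. -/
noncomputable def process {A B : Type*} (N : AbelianNetwork A B) (c : N.Config) (v : N.V)
    (e : {e : N.E // N.head e = some v}) : N.Config where
  state := Function.update c.state v ((N.proc v).trans e (c.state v))
  letters := fun d =>
    (if d = e.val then c.letters d - 1 else c.letters d) +
      (if h : N.tail d = some v then (N.proc v).out e (c.state v) ⟨d, h⟩ else 0)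

/-- One legal step: a letter waiting on some edge that has a head is processed. -/
def Step {A B : Type*} (N : AbelianNetwork A B) (c c' : N.Config) : Prop :=
  ∃ (v : N.V) (e : {e : N.E // N.head e = some v}),
    0 < c.letters e.val ∧ c' = N.process c v e

/-- All letters are on output and trash edges. -/
def Halted {A B : Type*} (N : AbelianNetwork A B) (c : N.Config) : Prop :=
  ∀ e, 0 < c.letters e → e ∈ Set.range N.output ∪ N.trash

/-- The network computes `F`: for each input vector `x` all legal executions halt, that is, there
is no infinite legal execution, and every legal execution that has halted leaves `F x b` letters
on the output edge labelled `b`, for each `b`. (An execution that has not halted can be continued,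
so halted total states are reached.) -/
def Computes {A B : Type*} (N : AbelianNetwork A B) (F : (A → ℕ) → B → ℕ) : Prop :=
  ∀ x : A → ℕ,
    (¬ ∃ s : ℕ → N.Config, s 0 = N.init x ∧ ∀ n, N.Step (s n) (s (n + 1))) ∧
    ∀ c, Relation.ReflTransGen N.Step (N.init x) c → N.Halted c →
      ∀ b, c.letters (N.output b) = F x b

/-- The network and the processor compute the same function. -/
def Emulates {A B Q : Type*} (N : AbelianNetwork A B) (P : AbelianProcessor A B Q) : Prop :=
  ∃ F : (A → ℕ) → B → ℕ, P.Computes F ∧ N.Computes F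

end AbelianNetwork

/-!
# Every finite abelian processor is emulated by an acyclic network of gates

Let `f : ℕ^A → ℕ` count the letters of one kind that the processor emits. It is increasing, its
increments are bounded, and it is affine up to an eventually periodic term in each variable. The
slope in the direction `a` does not depend on the other variables: once enough letters `a` have
been read, a power of `a` fixes the state, and commuting this power past any word shows that its
output stays the same (`AbelianProcessor.quasiLinear_eval`).

Each such function with `f 0 = 0` is built from the coordinates by sums and the one-variable gates
(`QuasiLinear.gateExpr`), by induction on the set of variables that occur. To eliminate `x a`, write
`f = ∑ i < d, ⌊(f + i) / d⌋` by Hermite's identity; a suitable `d` makes the growth of each summand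
`h` in `x a` as slow as possible.

* If `f` depends on `x a` only through `y = min (x a) r`, take `d` larger than its growth in `x a`.
  Then `h` has at most one jump in `y`, of size one, so that `h = ⌊(y + S) / (r + 1)⌋`, where
  `S`, the sum of `h` over `y = 0, …, r`, no longer involves `x a` (`GateExpr.sub_of_saturated`).
* If `f` grows by `c > 0` over each period `p` of `x a ≥ r`, take `d = c`. Then `h` grows by one
  over each period, and `h = ⌊((x a - r) + W) / p⌋` with truncated subtraction, where `W` is `p * h`
  for `x a < r`, and for `x a ≥ r` it is the sum of `h` over the period that starts at `r`. This `W`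
  is of the first kind (`GateExpr.sub_of_dependsOn`).

The constants `S 0` and `W 0` are absorbed by priming the toppler.

A function built from gates is turned into a network by attaching one gate at a time to output
edges, duplicating outputs by splitters (`AbelianNetwork.Realizable.of_gateExpr`). That an acyclic
network computes what its gates suggest is seen from a consistent assignment of letter counts to
the edges: going downstream, it bounds the number of letters that ever appear on each edge, whence
termination, and equals it once the execution has halted (`AbelianNetwork.Realizes.computes`).
-/

/-! ### Words read by abelian processors -/

namespace Processor

variable {A B Q : Type*} (P : Processor A B Q)

theorem transWord_append (w w' : List A) (q : Q) :
    P.transWord (w ++ w') q = P.transWord w' (P.transWord w q) := by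
  induction w generalizing q with
  | nil => rfl
  | cons i w ih => exact ih _

theorem outWord_append (w w' : List A) (q : Q) :
    P.outWord (w ++ w') q = P.outWord w q + P.outWord w' (P.transWord w q) := by
  induction w generalizing q with
  | nil => simp [outWord, transWord]
  | cons i w ih => simp [outWord, transWord, ih, add_assoc]

end Processor

namespace AbelianProcessor

variable {A B Q : Type*} (P : AbelianProcessor A B Q)

theorem transWord_perm {w w' : List A} (h : w.Perm w') (q : Q) :
    P.transWord w q = P.transWord w' q := by
  induction h generalizing q with
  | nil => rfl
  | cons i _ ih => exact ih _
  | swap i j w => simp only [Processor.transWord, P.trans_comm i j]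
  | trans _ _ ih₁ ih₂ => exact (ih₁ q).trans (ih₂ q)

theorem outWord_perm {w w' : List A} (h : w.Perm w') (q : Q) :
    P.outWord w q = P.outWord w' q := by
  induction h generalizing q with
  | nil => rfl
  | cons i _ ih => simp only [Processor.outWord, ih]
  | swap i j w =>
    simp only [Processor.outWord, P.trans_comm i j, ← add_assoc, P.out_comm i j]
  | trans _ _ ih₁ ih₂ => exact (ih₁ q).trans (ih₂ q)

theorem outWord_le_of_count_le [BEq A] [LawfulBEq A] {w w' : List A}
    (h : ∀ a, w.count a ≤ w'.count a) (q : Q) : P.outWord w q ≤ P.outWord w' q := by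
  rw [← P.outWord_perm (List.subperm_append_diff_self_of_count_le fun a _ => h a) q,
    Processor.outWord_append]
  exact le_self_add

/-! ### The function computed by a finite abelian processor -/

/-- A word that contains the letter `a` exactly `x a` times, for each `a`. -/
noncomputable def wordOf [Finite A] (x : A → ℕ) : List A :=
  (Finsupp.toMultiset (Finsupp.equivFunOnFinite.symm x)).toList

theorem count_wordOf [Finite A] [DecidableEq A] (x : A → ℕ) (a : A) :
    (wordOf x).count a = x a := by
  rw [← Multiset.coe_count, wordOf, Multiset.coe_toList, Finsupp.count_toMultiset]
  rfl

/-- The output of `P` on the input vector `x`, read in an arbitrary order. -/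
noncomputable def eval [Finite A] (x : A → ℕ) : B → ℕ :=
  P.outWord (wordOf x) P.start

theorem computes_eval [Finite A] : P.Computes P.eval := by
  classical
  intro w
  refine P.outWord_perm (List.perm_iff_count.2 fun a => ?_) _
  rw [count_wordOf]

theorem eval_update [Finite A] [DecidableEq A] (x : A → ℕ) (a : A) (n : ℕ) :
    P.eval (Function.update x a (x a + n)) =
      P.eval x + P.outWord (List.replicate n a) (P.transWord (wordOf x) P.start) := by
  rw [eval, eval, ← Processor.outWord_append]
  refine P.outWord_perm (List.perm_iff_count.2 fun b => ?_) _
  rw [count_wordOf, List.count_append, count_wordOf, List.count_replicate]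
  by_cases h : b = a
  · subst h; simp
  · simp [h, Ne.symm h]

theorem eval_mono [Finite A] : Monotone P.eval := by
  classical
  intro x y h
  exact P.outWord_le_of_count_le (fun a => by simpa only [count_wordOf] using h a) _

/-- A letter of a finite processor acts on the states in an eventually periodic way. -/
theorem exists_transWord_replicate_eq [Finite Q] (a : A) :
    ∃ r p : ℕ, 0 < p ∧ ∀ q,
      P.transWord (List.replicate p a) (P.transWord (List.replicate r a) q) =
        P.transWord (List.replicate r a) q := by
  obtain ⟨m, n, hne, heq⟩ := Finite.exists_ne_map_eq_of_infinite
    (fun n : ℕ => fun q => P.transWord (List.replicate n a) q)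
  wlog hlt : m < n generalizing m n
  · exact this n m hne.symm heq.symm (by omega)
  refine ⟨m, n - m, by omega, fun q => ?_⟩
  rw [← Processor.transWord_append, ← List.replicate_add, Nat.add_sub_cancel' hlt.le]
  exact (congrFun heq q).symm

/-- If a power of the letter `a` fixes the state `q`, then its output is the same in all states
reached from `q`: both orders of reading that power and a word `w` give the same total output. -/
theorem outWord_replicate_transWord (a : A) (p : ℕ) (w : List A) (q : Q)
    (hq : P.transWord (List.replicate p a) q = q) :
    P.outWord (List.replicate p a) (P.transWord w q) = P.outWord (List.replicate p a) q := by
  have h := P.outWord_perm (List.perm_append_comm (l₁ := w) (l₂ := List.replicate p a)) q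
  rw [Processor.outWord_append, Processor.outWord_append, hq, add_comm] at h
  exact add_right_cancel h

end AbelianProcessor

/-! ### Quasi-linear functions -/

/-- Increasing functions `f : ℕ^A → ℕ` with bounded increments that are, in each variable, affine
up to an eventually periodic term. The slope `c` and the period `p` in the direction `a` do not
depend on the values of the other variables. -/
structure QuasiLinear {A : Type*} [DecidableEq A] (f : (A → ℕ) → ℕ) : Prop where
  mono : Monotone f
  lipschitz : ∀ a, ∃ M, ∀ x, f (Function.update x a (x a + 1)) ≤ f x + M
  periodic : ∀ a, ∃ r p c, 0 < p ∧ ∀ x, r ≤ x a →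
    f (Function.update x a (x a + p)) = f x + c

theorem AbelianProcessor.quasiLinear_eval {A B Q : Type*} [Finite A] [DecidableEq A] [Finite Q]
    (P : AbelianProcessor A B Q) (b : B) : QuasiLinear (fun x => P.eval x b) where
  mono := fun x y h => P.eval_mono h b
  lipschitz := fun a => by
    cases nonempty_fintype Q
    refine ⟨∑ q, P.out a q b, fun x => ?_⟩
    simp only [P.eval_update x a 1, Pi.add_apply]
    refine Nat.add_le_add_left ?_ _
    simpa [Processor.outWord] using Finset.single_le_sum (f := fun q => P.out a q b)
      (fun _ _ => Nat.zero_le _) (Finset.mem_univ _)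
  periodic := fun a => by
    obtain ⟨r, p, hp, hper⟩ := P.exists_transWord_replicate_eq a
    refine ⟨r, p, P.outWord (List.replicate p a) (P.transWord (List.replicate r a) P.start) b, hp,
      fun x hx => ?_⟩
    have hperm : (wordOf x).Perm
        (List.replicate r a ++ wordOf (Function.update x a (x a - r))) := by
      refine List.perm_iff_count.2 fun c => ?_
      rw [count_wordOf, List.count_append, count_wordOf, List.count_replicate]
      by_cases h : c = a
      · subst h; simp [Nat.add_sub_cancel' hx]
      · simp [h, Ne.symm h]
    simp only [P.eval_update x a p, Pi.add_apply]
    rw [P.transWord_perm hperm, Processor.transWord_append,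
      P.outWord_replicate_transWord a p _ _ (hper _)]

namespace QuasiLinear

variable {A : Type*} [DecidableEq A] {f g : (A → ℕ) → ℕ}

theorem iterate_periodic {a : A} {r p c : ℕ}
    (h : ∀ x : A → ℕ, r ≤ x a → f (Function.update x a (x a + p)) = f x + c) (n : ℕ)
    (x : A → ℕ) (hx : r ≤ x a) : f (Function.update x a (x a + n * p)) = f x + n * c := by
  induction n with
  | zero => simp
  | succ n ih =>
    have := h (Function.update x a (x a + n * p)) (by simp; omega)
    rw [Function.update_self, Function.update_idem, ih] at this
    rw [Nat.succ_mul, Nat.succ_mul, ← add_assoc, this, add_assoc]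

theorem iterate_lipschitz {a : A} {M : ℕ}
    (h : ∀ x : A → ℕ, f (Function.update x a (x a + 1)) ≤ f x + M) (n : ℕ) (x : A → ℕ) :
    f (Function.update x a (x a + n)) ≤ f x + n * M := by
  induction n with
  | zero => simp
  | succ n ih =>
    have := h (Function.update x a (x a + n))
    rw [Function.update_self, Function.update_idem] at this
    rw [Nat.succ_mul, ← add_assoc]
    omega

theorem const (n : ℕ) : QuasiLinear (fun _ : A → ℕ => n) where
  mono := monotone_const
  lipschitz := fun _ => ⟨0, fun _ => le_rfl⟩
  periodic := fun _ => ⟨0, 1, 0, one_pos, fun _ _ => rfl⟩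

theorem add (hf : QuasiLinear f) (hg : QuasiLinear g) : QuasiLinear (fun x => f x + g x) where
  mono := hf.mono.add hg.mono
  lipschitz := fun a => by
    obtain ⟨M, hM⟩ := hf.lipschitz a
    obtain ⟨N, hN⟩ := hg.lipschitz a
    exact ⟨M + N, fun x => by have := hM x; have := hN x; omega⟩
  periodic := fun a => by
    obtain ⟨r, p, c, hp, h⟩ := hf.periodic a
    obtain ⟨s, q, d, hq, k⟩ := hg.periodic a
    refine ⟨max r s, q * p, q * c + p * d, Nat.mul_pos hq hp, fun x hx => ?_⟩
    have h' := iterate_periodic h q x (by omega)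
    have k' := iterate_periodic k p x (by omega)
    rw [mul_comm p q] at k'
    rw [h', k']
    ring

theorem sum {ι : Type*} (s : Finset ι) (F : ι → (A → ℕ) → ℕ) (h : ∀ i, QuasiLinear (F i)) :
    QuasiLinear (fun x => ∑ i ∈ s, F i x) := by
  classical
  induction s using Finset.induction_on with
  | empty => simpa using const 0
  | insert i s hi ih => simpa [Finset.sum_insert hi] using (h i).add ih

theorem add_div (hf : QuasiLinear f) (i : ℕ) {d : ℕ} (hd : 0 < d) :
    QuasiLinear (fun x => (f x + i) / d) where
  mono := fun x y h => Nat.div_le_div_right (Nat.add_le_add_right (hf.mono h) i)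
  lipschitz := fun a => by
    obtain ⟨M, hM⟩ := hf.lipschitz a
    refine ⟨M, fun x => ?_⟩
    calc (f (Function.update x a (x a + 1)) + i) / d ≤ (f x + i + d * M) / d := by
          refine Nat.div_le_div_right ?_
          have := hM x
          have := Nat.le_mul_of_pos_left M hd
          omega
      _ = (f x + i) / d + M := Nat.add_mul_div_left _ _ hd
  periodic := fun a => by
    obtain ⟨r, p, c, hp, h⟩ := hf.periodic a
    refine ⟨r, d * p, c, Nat.mul_pos hd hp, fun x hx => ?_⟩
    rw [iterate_periodic h d x hx, ← Nat.add_mul_div_left _ _ hd]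
    congr 1
    ring

/-- Quasi-linearity is kept when one variable is replaced by an increasing, eventually constant
function of that variable. -/
theorem comp_update (hf : QuasiLinear f) (a : A) {ψ : ℕ → ℕ} (hψ : Monotone ψ) (R : ℕ)
    (hR : ∀ n, R ≤ n → ψ n = ψ R) :
    QuasiLinear (fun x => f (Function.update x a (ψ (x a)))) where
  mono := fun x y h => hf.mono <| by
    intro b
    by_cases hb : b = a
    · subst hb; simpa using hψ (h b)
    · simpa [hb] using h b
  lipschitz := fun b => by
    obtain ⟨M, hM⟩ := hf.lipschitz b
    by_cases hb : b = a
    · subst hb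
      refine ⟨ψ R * M, fun x => ?_⟩
      have hle : ψ (x b + 1) ≤ ψ R := by
        rcases le_total (x b + 1) R with h | h
        · exact hψ h
        · exact (hR _ h).le
      have h₁ : ψ (x b + 1) ≤ ψ (x b) + ψ R := by omega
      have h₂ := iterate_lipschitz hM (ψ R) (Function.update x b (ψ (x b)))
      simp only [Function.update_self, Function.update_idem] at h₂ ⊢
      exact (hf.mono (Function.update_mono h₁)).trans h₂
    · refine ⟨M, fun x => ?_⟩
      have := hM (Function.update x a (ψ (x a)))
      rw [Function.update_of_ne hb, Function.update_comm (Ne.symm hb)] at this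
      simpa [Ne.symm hb] using this
  periodic := fun b => by
    by_cases hb : b = a
    · subst hb
      refine ⟨R, 1, 0, one_pos, fun x hx => ?_⟩
      simp [hR _ hx, hR (x b + 1) (by omega)]
    · obtain ⟨r, p, c, hp, h⟩ := hf.periodic b
      refine ⟨r, p, c, hp, fun x hx => ?_⟩
      have := h (Function.update x a (ψ (x a))) (by simpa [hb] using hx)
      rw [Function.update_of_ne hb, Function.update_comm (Ne.symm hb)] at this
      simpa [Ne.symm hb] using this

end QuasiLinear

/-! ### Floors of quotients -/

/-- Hermite's identity. -/
theorem sum_range_add_div (n : ℕ) {d : ℕ} (hd : 0 < d) :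
    ∑ i ∈ Finset.range d, (n + i) / d = n := by
  induction n with
  | zero =>
    refine Finset.sum_eq_zero fun i hi => ?_
    rw [zero_add, Nat.div_eq_of_lt (Finset.mem_range.1 hi)]
  | succ n ih =>
    have h₁ := Finset.sum_range_succ (fun i => (n + i) / d) d
    have h₂ := Finset.sum_range_succ' (fun i => (n + i) / d) d
    rw [Nat.add_div_right _ hd] at h₁
    have h₃ : ∑ i ∈ Finset.range d, (n + 1 + i) / d = ∑ i ∈ Finset.range d, (n + (i + 1)) / d :=
      Finset.sum_congr rfl fun i _ => by rw [add_right_comm, add_assoc]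
    simp only [add_zero] at h₂
    omega

/-- An increasing sequence with at most one jump, of size one, between the indices `0` and `r` is
recovered from the sum of its values: the sum counts the indices after the jump. -/
theorem eq_add_sum_div_of_le_add_one {u : ℕ → ℕ} (hu : Monotone u) {r : ℕ}
    (h : u r ≤ u 0 + 1) {y : ℕ} (hy : y ≤ r) :
    u y = (y + ∑ j ∈ Finset.range (r + 1), u j) / (r + 1) := by
  symm
  rw [Nat.div_eq_iff (Nat.succ_pos r)]
  have hsplit := Finset.sum_range_add_sum_Ico u (show y ≤ r + 1 by omega)
  have hsplit' := Finset.sum_range_add_sum_Ico u (show y + 1 ≤ r + 1 by omega)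
  have hy0 : u 0 ≤ u y := hu (Nat.zero_le y)
  have hy1 : u y ≤ u 0 + 1 := (hu hy).trans h
  -- Indices `j ≥ y` have `u j ≥ u y`, indices `j ≤ y` have `u j ≤ u y`.
  have h₁ : (r + 1 - y) * u y ≤ ∑ j ∈ Finset.Ico y (r + 1), u j := by
    simpa using Finset.card_nsmul_le_sum (Finset.Ico y (r + 1)) u (u y)
      fun j hj => hu (Finset.mem_Ico.1 hj).1
  have h₂ : y * u 0 ≤ ∑ j ∈ Finset.range y, u j := by
    simpa using Finset.card_nsmul_le_sum (Finset.range y) u (u 0) fun j _ => hu (Nat.zero_le j)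
  have h₃ : ∑ j ∈ Finset.range (y + 1), u j ≤ (y + 1) * u y := by
    simpa using Finset.sum_le_card_nsmul (Finset.range (y + 1)) u (u y)
      fun j hj => hu (by simpa [Nat.lt_succ_iff] using hj)
  have h₄ : ∑ j ∈ Finset.Ico (y + 1) (r + 1), u j ≤ (r - y) * (u 0 + 1) := by
    simpa using Finset.sum_le_card_nsmul (Finset.Ico (y + 1) (r + 1)) u (u 0 + 1)
      fun j hj => (hu (Nat.lt_succ_iff.1 (Finset.mem_Ico.1 hj).2)).trans h
  obtain ⟨k, rfl⟩ := Nat.exists_eq_add_of_le hy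
  rw [show y + k + 1 - y = k + 1 by omega] at h₁
  rw [show y + k - y = k by omega] at h₄
  rw [Nat.succ_eq_add_one]
  obtain ⟨t, ht⟩ : ∃ t, u y * (y + k + 1) + (y + k + 1) - 1 = t ∧
      t = u y * (y + k + 1) + (y + k) := ⟨_, rfl, by omega⟩
  rw [ht.1, ht.2]
  rcases (show u y = u 0 ∨ u y = u 0 + 1 by omega) with hy' | hy' <;> rw [hy'] at h₁ h₃ ⊢ <;>
    constructor <;> linarith

/-- An increasing sequence that grows by one over each period `p` is a rounded linear function. -/
theorem eq_add_sum_div_of_periodic {v : ℕ → ℕ} (hv : Monotone v) {p : ℕ} (hp : 0 < p)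
    (h : ∀ n, v (n + p) = v n + 1) (n : ℕ) :
    v n = (n + ∑ j ∈ Finset.range p, v j) / p := by
  induction n using Nat.strong_induction_on with
  | _ n ih =>
    rcases lt_or_ge n p with hn | hn
    · obtain ⟨r, rfl⟩ := Nat.exists_eq_succ_of_ne_zero hp.ne'
      refine eq_add_sum_div_of_le_add_one hv ?_ (Nat.lt_succ_iff.1 hn)
      have := h 0
      have := hv (show r ≤ 0 + r.succ by omega)
      omega
    · obtain ⟨m, rfl⟩ := Nat.exists_eq_add_of_le' hn
      rw [h, ih m (by omega), add_right_comm, Nat.add_div_right _ hp]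

/-! ### Functions built from gates -/

/-- The functions `ℕ^A → ℕ` obtained from the coordinates by sums and by composition with the
functions of the topplers, the delayer and the presink. -/
inductive GateExpr {A : Type*} : ((A → ℕ) → ℕ) → Prop
  | proj (a : A) : GateExpr fun x => x a
  | add {f g : (A → ℕ) → ℕ} : GateExpr f → GateExpr g → GateExpr fun x => f x + g x
  | toppler {f : (A → ℕ) → ℕ} (n : ℕ) (hn : 2 ≤ n) (q : Fin n) :
      GateExpr f → GateExpr fun x => (q + f x) / n
  | delayer {f : (A → ℕ) → ℕ} : GateExpr f → GateExpr fun x => f x - 1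
  | presink {f : (A → ℕ) → ℕ} : GateExpr f → GateExpr fun x => min (f x) 1

namespace GateExpr

variable {A : Type*} {f g : (A → ℕ) → ℕ}

theorem zero [Nonempty A] : GateExpr fun _ : A → ℕ => 0 := by
  have h := (proj (Classical.arbitrary A)).presink.delayer
  convert h using 2 with x
  omega

theorem sum [Nonempty A] {ι : Type*} (s : Finset ι) {F : ι → (A → ℕ) → ℕ}
    (h : ∀ i ∈ s, GateExpr (F i)) : GateExpr fun x => ∑ i ∈ s, F i x := by
  classical
  induction s using Finset.induction_on with
  | empty => simpa using zero
  | insert i s hi ih =>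
    simpa [Finset.sum_insert hi] using
      (h i (by simp)).add (ih fun j hj => h j (by simp [hj]))

theorem add_div (hf : GateExpr f) {q n : ℕ} (hq : q < n) : GateExpr fun x => (q + f x) / n := by
  rcases Nat.lt_or_ge n 2 with hn | hn
  · obtain rfl : n = 1 := by omega
    obtain rfl : q = 0 := by omega
    simpa using hf
  · exact hf.toppler n hn ⟨q, hq⟩

theorem sub (hf : GateExpr f) (r : ℕ) : GateExpr fun x => f x - r := by
  induction r with
  | zero => simpa using hf
  | succ r ih => exact ih.delayer

theorem min [Nonempty A] (hf : GateExpr f) (r : ℕ) : GateExpr fun x => Min.min (f x) r := by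
  induction r with
  | zero => simpa using zero
  | succ r ih =>
    convert ih.add (hf.sub r).presink using 2 with x
    omega

/-- If `W - W 0` is built from gates then so is `(g + W) / n`, up to its value at `0`: the constant
`W 0` is absorbed into the priming of a toppler. -/
theorem sub_of_eq_div {h W : (A → ℕ) → ℕ} {n : ℕ} (hn : 0 < n) (hg : GateExpr g) (hg0 : g 0 = 0)
    (hW : GateExpr fun x => W x - W 0) (hmono : Monotone W) (heq : ∀ x, h x = (g x + W x) / n) :
    GateExpr fun x => h x - h 0 := by
  convert (hg.add hW).add_div (Nat.mod_lt (W 0) hn) using 2 with x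
  have hW0 : W 0 ≤ W x := hmono (fun a => Nat.zero_le (x a))
  have h₁ : g x + W x = (W 0 % n + (g x + (W x - W 0))) + n * (W 0 / n) := by
    have := Nat.mod_add_div (W 0) n
    omega
  rw [heq x, heq 0, hg0, zero_add, h₁, Nat.add_mul_div_left _ _ hn, Nat.add_sub_cancel]

/-- By Hermite's identity it suffices to build the functions `(f + i) / d`. -/
theorem sub_of_forall_add_div [Nonempty A] (hf : Monotone f) {d : ℕ} (hd : 0 < d)
    (h : ∀ i, GateExpr fun x => (f x + i) / d - (f 0 + i) / d) : GateExpr fun x => f x - f 0 := by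
  convert sum (Finset.range d) fun i _ => h i using 2 with x
  rw [Finset.sum_tsub_distrib, sum_range_add_div _ hd, sum_range_add_div _ hd]
  intro i _
  exact Nat.div_le_div_right (Nat.add_le_add_right (hf fun a => Nat.zero_le (x a)) i)

variable [DecidableEq A]

/-- The induction step in a variable `a` on which `f` depends only through `min (x a) r`. -/
theorem sub_of_saturated [Nonempty A] {s : Finset A} {a : A}
    (ih : ∀ f : (A → ℕ) → ℕ, QuasiLinear f → DependsOn f (s : Set A) →
      GateExpr fun x => f x - f 0)
    {f : (A → ℕ) → ℕ} (hf : QuasiLinear f) (hdep : DependsOn f (insert a s : Set A)) {r : ℕ}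
    (hr : ∀ x, f (Function.update x a (Min.min (x a) r)) = f x) :
    GateExpr fun x => f x - f 0 := by
  obtain ⟨M, hM⟩ := hf.lipschitz a
  -- Each summand `(f + i) / d` grows by at most one as `x a` runs through all of `ℕ`.
  obtain ⟨d, hd⟩ : ∃ d, d = r * M + 1 := ⟨_, rfl⟩
  refine sub_of_forall_add_div hf.mono (d := d) (by omega) fun i => ?_
  have hq := hf.add_div i (d := d) (by omega)
  obtain ⟨S, hS⟩ : ∃ S : (A → ℕ) → ℕ,
    S = fun x => ∑ j ∈ Finset.range (r + 1), (f (Function.update x a j) + i) / d := ⟨_, rfl⟩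
  have hSql : QuasiLinear S := by
    rw [hS]
    exact QuasiLinear.sum _ _ fun j =>
      hq.comp_update a (ψ := fun _ => j) monotone_const 0 fun _ _ => rfl
  have hSdep : DependsOn S (s : Set A) := by
    intro x y hxy
    rw [hS]
    refine Finset.sum_congr rfl fun j _ => ?_
    rw [hdep fun b hb => ?_]
    by_cases hba : b = a
    · subst hba; simp
    · simpa [hba] using hxy b (by simpa [hba] using hb)
  refine sub_of_eq_div (h := fun x => (f x + i) / d) (n := r + 1) (Nat.succ_pos r)
    ((proj a).min r) (by simp) (ih S hSql hSdep) hSql.mono fun x => ?_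
  have hu : Monotone fun j => (f (Function.update x a j) + i) / d := fun j k hjk =>
    hq.mono (Function.update_mono hjk)
  have hjump : (f (Function.update x a r) + i) / d ≤ (f (Function.update x a 0) + i) / d + 1 := by
    have := QuasiLinear.iterate_lipschitz hM r (Function.update x a 0)
    simp only [Function.update_self, Function.update_idem, zero_add] at this
    rw [← Nat.add_div_right _ (by omega)]
    exact Nat.div_le_div_right (by omega)
  simpa [hr, hS] using eq_add_sum_div_of_le_add_one hu hjump (min_le_right (x a) r)

/-- Induction on the set of variables on which `f` depends. -/
theorem sub_of_dependsOn [Nonempty A] (s : Finset A) :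
    ∀ f : (A → ℕ) → ℕ, QuasiLinear f → DependsOn f (s : Set A) →
      GateExpr fun x => f x - f 0 := by
  induction s using Finset.induction_on with
  | empty =>
    intro f _ hdep
    convert zero (A := A) using 2 with x
    rw [hdep (x := x) (y := 0) (by simp), Nat.sub_self]
  | insert a s _ ih =>
    intro f hf hdep
    rw [Finset.coe_insert] at hdep
    obtain ⟨r, p, c, hp, hper⟩ := hf.periodic a
    rcases Nat.eq_zero_or_pos c with rfl | hc
    · refine sub_of_saturated ih hf hdep (r := r) fun x => ?_
      rcases le_total (x a) r with h | h
      · simp [h]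
      rw [min_eq_right h]
      refine le_antisymm (hf.mono ?_) ?_
      · simpa using Function.update_mono (f := x) (i := a) h
      · have := QuasiLinear.iterate_periodic hper (x a) (Function.update x a r) (by simp)
        simp only [Function.update_self, Function.update_idem, mul_zero, add_zero] at this
        rw [← this]
        refine hf.mono ?_
        have hle : x a ≤ r + x a * p := by nlinarith
        simpa using Function.update_mono (f := x) (i := a) hle
    · refine sub_of_forall_add_div hf.mono hc fun i => ?_
      have hq := hf.add_div i hc
      -- `W` agrees with `p * (f + i) / c` below `r` and is constant in `x a` from `r` on.
      obtain ⟨ψ, hψ⟩ : ∃ ψ : ℕ → ℕ → ℕ, ψ = fun j n => if n < r then n else r + j := ⟨_, rfl⟩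
      obtain ⟨W, hW⟩ : ∃ W : (A → ℕ) → ℕ, W = fun x => ∑ j ∈ Finset.range p,
        (f (Function.update x a (ψ j (x a))) + i) / c := ⟨_, rfl⟩
      have hWql : QuasiLinear W := by
        rw [hW]
        refine QuasiLinear.sum _ _ fun j => hq.comp_update a (ψ := ψ j) ?_ r ?_
        · intro m n hmn
          simp only [hψ]
          split_ifs <;> omega
        · intro n hn
          simp [hψ, hn]
      have hWdep : DependsOn W (insert a s : Set A) := by
        intro x y hxy
        rw [hW]
        refine Finset.sum_congr rfl fun j _ => ?_
        rw [hdep fun b hb => ?_]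
        by_cases hba : b = a
        · subst hba; simp [hxy b hb]
        · simpa [hba] using hxy b hb
      have hWsat : ∀ x, W (Function.update x a (Min.min (x a) r)) = W x := by
        intro x
        rw [hW]
        refine Finset.sum_congr rfl fun j _ => ?_
        have : ψ j (Min.min (x a) r) = ψ j (x a) := by
          simp only [hψ]
          split_ifs <;> omega
        rw [Function.update_self, Function.update_idem, this]
      refine sub_of_eq_div (h := fun x => (f x + i) / c) hp ((proj a).sub r) (by simp)
        (sub_of_saturated ih hWql hWdep hWsat) hWql.mono fun x => ?_
      rcases Nat.lt_or_ge (x a) r with hlt | hge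
      · have : W x = p * ((f x + i) / c) := by simp [hW, hψ, hlt]
        rw [this, Nat.sub_eq_zero_of_le hlt.le, zero_add, Nat.mul_div_cancel_left _ hp]
      · have hv : Monotone fun n => (f (Function.update x a (r + n)) + i) / c := fun m n hmn =>
          hq.mono (Function.update_mono (Nat.add_le_add_left hmn r))
        have hstep : ∀ n, (f (Function.update x a (r + (n + p))) + i) / c =
            (f (Function.update x a (r + n)) + i) / c + 1 := by
          intro n
          have := hper (Function.update x a (r + n)) (by simp)
          rw [Function.update_self, Function.update_idem, add_assoc] at this
          rw [this, ← Nat.add_div_right _ hc, add_right_comm]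
        have := eq_add_sum_div_of_periodic hv hp hstep (x a - r)
        simpa [hW, hψ, hge.not_gt, Nat.add_sub_cancel' hge] using this

end GateExpr

/-- Every quasi-linear function with `f 0 = 0` is built from gates. -/
theorem QuasiLinear.gateExpr {A : Type*} [Finite A] [Nonempty A] [DecidableEq A]
    {f : (A → ℕ) → ℕ} (hf : QuasiLinear f) (h0 : f 0 = 0) : GateExpr f := by
  cases nonempty_fintype A
  have hdep : DependsOn f ((Finset.univ : Finset A) : Set A) := by
    intro x y h
    rw [funext fun a => h a (by simp)]
  simpa [h0] using GateExpr.sub_of_dependsOn Finset.univ f hf hdep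

/-! ### Executions of acyclic networks -/

namespace AbelianNetwork

variable {A B : Type*} (N : AbelianNetwork A B)

open Classical in
/-- `val` is consistent: at each node, some word with `val e` letters on each incoming edge `e`
makes the processor emit `val d` letters on each outgoing edge `d`. By abelianness the choice of
the word does not matter. -/
def Consistent (val : N.E → ℕ) : Prop :=
  ∀ v, ∃ w : List {e // N.head e = some v}, (∀ e, w.count e = val e.val) ∧
    ∀ d, (N.proc v).outWord w (N.proc v).start d = val d.val

/-- The network consists of gates, is acyclic (the rank of the nodes increases along the edges), and
on the input `x` it has a consistent edge valuation with the value `g r x` on the output `r`. -/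
structure Realizes (g : B → (A → ℕ) → ℕ) : Prop where
  gates : ∀ v, (N.proc v).IsLogicGate
  rank : ∃ rank : N.V → ℕ, ∀ u v, N.Adj u v → rank u < rank v
  val : ∀ x, ∃ val : N.E → ℕ, (∀ a, val (N.input a) = x a) ∧ N.Consistent val ∧
    ∀ b, val (N.output b) = g b x

variable {N}

theorem directedAcyclic_of_rank {rank : N.V → ℕ} (h : ∀ u v, N.Adj u v → rank u < rank v) :
    N.DirectedAcyclic := by
  have key : ∀ u v, Relation.TransGen N.Adj u v → rank u < rank v := by
    intro u v huv
    induction huv with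
    | single h' => exact h _ _ h'
    | tail _ h' ih => exact ih.trans (h _ _ h')
  exact fun v hv => (key v v hv).false

open Classical in
/-- The configuration `c` is explained by `n` letters having been processed so far: `used e` of them
from the edge `e`, and the processor at `v` has read the word `w v`. -/
structure History (x : A → ℕ) (n : ℕ) (c : N.Config) (used : N.E → ℕ)
    (w : ∀ v, List {e // N.head e = some v}) : Prop where
  count : ∀ v e, (w v).count e = used e.val
  used_of_head : ∀ e, N.head e = none → used e = 0
  state : ∀ v, c.state v = (N.proc v).transWord (w v) (N.proc v).start
  letters_input : ∀ a, c.letters (N.input a) + used (N.input a) = x a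
  letters_edge : ∀ v (d : {d // N.tail d = some v}),
    c.letters d.val + used d.val = (N.proc v).outWord (w v) (N.proc v).start d
  total : ∑ᶠ e, used e = n

theorem tail_input (a : A) : N.tail (N.input a) = none :=
  (N.tail_eq_none_iff _).2 ⟨a, rfl⟩

theorem head_output (b : B) : N.head (N.output b) = none :=
  (N.head_eq_none_iff _).2 (Or.inl ⟨b, rfl⟩)

theorem history_init (x : A → ℕ) :
    History (N := N) x 0 (N.init x) (fun _ => 0) (fun _ => []) where
  count := by simp
  used_of_head := fun _ _ => rfl
  state := fun _ => rfl
  letters_input := fun a => by simp [init, N.input.injective.extend_apply]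
  letters_edge := fun v d => by
    have hd : ¬ ∃ a, N.input a = d.val := by
      rintro ⟨a, ha⟩
      have := d.2
      rw [← ha, tail_input] at this
      cases this
    simp [init, Function.extend_apply' _ _ _ hd, Processor.outWord]
  total := by simp

theorem History.step {x : A → ℕ} {n : ℕ} {c c' : N.Config} {used : N.E → ℕ}
    {w : ∀ v, List {e // N.head e = some v}} (h : History x n c used w) (hs : N.Step c c') :
    ∃ used' w', History x (n + 1) c' used' w' := by
  classical
  obtain ⟨v, e, hpos, rfl⟩ := hs
  have := N.finite_E
  cases nonempty_fintype N.E
  have hletters : ∀ d, (if d = e.val then c.letters d - 1 else c.letters d) +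
      (used d + if d = e.val then 1 else 0) = c.letters d + used d := by
    intro d
    split_ifs with hd
    · subst hd; omega
    · omega
  refine ⟨fun d => used d + if d = e.val then 1 else 0,
    Function.update w v (w v ++ [e]), ?_, ?_, ?_, ?_, ?_, ?_⟩
  · intro u d
    by_cases hu : u = v
    · subst hu
      have := h.count u d
      simp only [Function.update_self, List.count_append, List.count_singleton, beq_iff_eq,
        Subtype.ext_iff, eq_comm (a := e.val)]
      omega
    · have hde : d.val ≠ e.val := by
        intro hde
        have h₁ := d.2
        rw [hde, e.2] at h₁
        exact hu (Option.some_injective _ h₁).symm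
      simpa [hu, hde] using h.count u d
  · intro d hd
    have hde : d ≠ e.val := by
      rintro rfl
      rw [e.2] at hd
      cases hd
    simpa [hde] using h.used_of_head d hd
  · intro u
    by_cases hu : u = v
    · subst hu
      simp [process, Processor.transWord_append, Processor.transWord, h.state]
    · simpa [process, hu] using h.state u
  · intro a
    simp only [process, tail_input, reduceCtorEq, dite_false, add_zero]
    rw [hletters, h.letters_input]
  · intro u d
    have hd := h.letters_edge u d
    simp only [process]
    rw [add_right_comm, hletters, hd]
    by_cases hu : u = v
    · subst hu
      simp [d.2, Processor.outWord_append, Processor.outWord, h.state]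
    · have : ¬ N.tail d.val = some v := by rw [d.2]; simpa using hu
      simp [this, hu]
  · have := h.total
    rw [finsum_eq_sum_of_fintype] at this ⊢
    simp [Finset.sum_add_distrib, this]

theorem History.of_reflTransGen {x : A → ℕ} {c : N.Config}
    (h : Relation.ReflTransGen N.Step (N.init x) c) :
    ∃ n used w, History x n c used w := by
  induction h with
  | refl => exact ⟨0, _, _, history_init x⟩
  | tail _ hs ih =>
    obtain ⟨n, used, w, h⟩ := ih
    exact ⟨n + 1, h.step hs⟩

/-- To prove a property of all edges of an acyclic network, go from the inputs downstream. -/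
theorem edge_induction {rank : N.V → ℕ} (hrank : ∀ u v, N.Adj u v → rank u < rank v)
    {p : N.E → Prop} (hin : ∀ a, p (N.input a))
    (hnode : ∀ v, (∀ e : {e // N.head e = some v}, p e.val) →
      ∀ d : {d // N.tail d = some v}, p d.val) (e : N.E) : p e := by
  have key : ∀ n e, (∀ v, N.tail e = some v → rank v < n) → p e := by
    intro n
    induction n with
    | zero =>
      intro e he
      cases ht : N.tail e with
      | none =>
        obtain ⟨a, rfl⟩ := (N.tail_eq_none_iff e).1 ht
        exact hin a
      | some v => exact absurd (he v ht) (Nat.not_lt_zero _)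
    | succ n ih =>
      intro e he
      cases ht : N.tail e with
      | none =>
        obtain ⟨a, rfl⟩ := (N.tail_eq_none_iff e).1 ht
        exact hin a
      | some v =>
        refine hnode v (fun e' => ih e'.val fun u hu => ?_) ⟨e, ht⟩
        exact (hrank u v ⟨e'.val, hu, e'.2⟩).trans_le (Nat.lt_succ_iff.1 (he v ht))
  cases ht : N.tail e with
  | none => exact key 0 e fun v hv => by rw [ht] at hv; cases hv
  | some v =>
    refine key (rank v + 1) e fun u hu => ?_
    obtain rfl : v = u := Option.some_injective _ (ht.symm.trans hu)
    exact Nat.lt_succ_self _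

/-- A consistent valuation bounds the number of letters that ever appear on each edge. -/
theorem History.letters_add_used_le {rank : N.V → ℕ}
    (hrank : ∀ u v, N.Adj u v → rank u < rank v) {val : N.E → ℕ} (hval : N.Consistent val)
    {x : A → ℕ} (hx : ∀ a, val (N.input a) = x a) {n : ℕ} {c : N.Config} {used : N.E → ℕ}
    {w : ∀ v, List {e // N.head e = some v}} (h : History x n c used w) (e : N.E) :
    c.letters e + used e ≤ val e := by
  classical
  induction e using edge_induction hrank with
  | hin a => rw [h.letters_input, hx]
  | hnode v ih d =>
    obtain ⟨w', hw', hout⟩ := hval v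
    rw [h.letters_edge v d, ← hout d]
    refine (N.proc v).outWord_le_of_count_le (fun e => ?_) _ d
    have h₁ := ih e
    have h₂ := hw' e
    have h₃ := h.count v e
    rw [h₂, h₃]
    omega

/-- In a halted configuration a consistent valuation gives the number of letters that have ever
appeared on each edge. -/
theorem History.letters_add_used_eq {rank : N.V → ℕ}
    (hrank : ∀ u v, N.Adj u v → rank u < rank v) {val : N.E → ℕ} (hval : N.Consistent val)
    {x : A → ℕ} (hx : ∀ a, val (N.input a) = x a) {n : ℕ} {c : N.Config} {used : N.E → ℕ}
    {w : ∀ v, List {e // N.head e = some v}} (h : History x n c used w) (hc : N.Halted c)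
    (e : N.E) : c.letters e + used e = val e := by
  classical
  induction e using edge_induction hrank with
  | hin a => rw [h.letters_input, hx]
  | hnode v ih d =>
    obtain ⟨w', hw', hout⟩ := hval v
    rw [h.letters_edge v d, ← hout d]
    refine congrFun ((N.proc v).outWord_perm (List.perm_iff_count.2 fun e => ?_) _) d
    have h₀ : c.letters e.val = 0 := by
      by_contra hne
      have := (N.head_eq_none_iff e.val).2 (hc e.val (Nat.pos_of_ne_zero hne))
      rw [e.2] at this
      cases this
    have h₁ := ih e
    have h₂ := hw' e
    have h₃ := h.count v e
    rw [h₀, zero_add] at h₁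
    rw [h₂, ← h₁, h₃]

theorem Realizes.computes {g : B → (A → ℕ) → ℕ} (h : N.Realizes g) :
    N.Computes fun x b => g b x := by
  obtain ⟨rank, hrank⟩ := h.rank
  have := N.finite_E
  cases nonempty_fintype N.E
  intro x
  obtain ⟨val, hx, hval, hout⟩ := h.val x
  constructor
  · rintro ⟨s, hs0, hs⟩
    have key : ∀ n, ∃ used w, History x n (s n) used w := by
      intro n
      induction n with
      | zero => rw [hs0]; exact ⟨_, _, history_init x⟩
      | succ n ih =>
        obtain ⟨used, w, hist⟩ := ih
        exact hist.step (hs n)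
    obtain ⟨used, w, hist⟩ := key (∑ e, val e + 1)
    have htot := hist.total
    rw [finsum_eq_sum_of_fintype] at htot
    have : ∑ e, used e ≤ ∑ e, val e := Finset.sum_le_sum fun e _ =>
      le_of_add_le_right (hist.letters_add_used_le hrank hval hx e)
    omega
  · intro c hc hhalt b
    obtain ⟨n, used, w, hist⟩ := History.of_reflTransGen hc
    have := hist.letters_add_used_eq hrank hval hx hhalt (N.output b)
    rwa [hist.used_of_head _ (head_output b), add_zero, hout] at this

end AbelianNetwork

/-! ### Functions computed by the gates -/

namespace Gate

theorem adder_computes : adder.Computes fun x _ => x 0 + x 1 := by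
  classical
  intro w
  funext b
  -- The counts in `Computes` use the classical decidability instance.
  suffices h : adder.outWord w () b = w.count 0 + w.count 1 by
    refine Eq.trans h ?_
    congr!
  induction w with
  | nil => rfl
  | cons i w ih =>
    change 1 + adder.outWord w () b = _
    rw [ih, List.count_cons, List.count_cons]
    fin_cases i <;> simp <;> omega

/-- For a processor with a single input letter only the length of the input word matters. -/
theorem computes_of_length {B Q : Type*} {P : AbelianProcessor Unit B Q} {f : ℕ → ℕ}
    (h : ∀ w b, P.outWord w P.start b = f w.length) : P.Computes fun x _ => f (x ()) := by
  intro w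
  funext b
  rw [h]
  have hw : w.count () = w.length := List.count_eq_length.2 fun _ _ => rfl
  refine congrArg f (hw.symm.trans ?_)
  -- The counts in `Computes` use the classical decidability instance.
  congr!

theorem splitter_outWord (w : List Unit) (b : Fin 2) : splitter.outWord w () b = w.length := by
  induction w with
  | nil => rfl
  | cons i w ih =>
    change 1 + splitter.outWord w () b = w.length + 1
    rw [ih, add_comm]

theorem splitter_computes : splitter.Computes fun x _ => x () :=
  computes_of_length (f := id) splitter_outWord

theorem topplerProcessor_outWord (n : ℕ) (w : List Unit) (q : Fin n) (b : Unit) :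
    (topplerProcessor n).outWord w q b = (q + w.length) / n := by
  induction w generalizing q with
  | nil => simp [Processor.outWord, Nat.div_eq_of_lt q.isLt]
  | cons i w ih =>
    have hn : 0 < n := Nat.zero_lt_of_lt q.isLt
    simp only [Processor.outWord, Pi.add_apply, ih, List.length_cons]
    simp only [topplerProcessor, topplerNext]
    split_ifs with h
    · rw [h, Nat.mod_self, zero_add, show (q : ℕ) + (w.length + 1) = w.length + n by omega,
        Nat.add_div_right _ hn, add_comm]
    · rw [Nat.mod_eq_of_lt (by omega), zero_add]
      congr 1
      omega

theorem toppler_computes (n : ℕ) (hn : 2 ≤ n) (q : Fin n) :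
    (toppler n hn q).Computes fun x _ => (q + x ()) / n :=
  computes_of_length (f := fun m => (q + m) / n) fun w b => topplerProcessor_outWord n w q b

theorem delayer_outWord_true (w : List Unit) (b : Unit) : delayer.outWord w true b = w.length := by
  induction w with
  | nil => rfl
  | cons i w ih =>
    change 1 + delayer.outWord w true b = w.length + 1
    rw [ih, add_comm]

theorem delayer_computes : delayer.Computes fun x _ => x () - 1 := by
  refine computes_of_length (f := fun m => m - 1) fun w b => ?_
  cases w with
  | nil => rfl
  | cons i w =>
    change 0 + delayer.outWord w true b = w.length
    rw [delayer_outWord_true, zero_add]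

theorem presink_outWord_true (w : List Unit) (b : Unit) : presink.outWord w true b = 0 := by
  induction w with
  | nil => rfl
  | cons i w ih =>
    change 0 + presink.outWord w true b = 0
    rw [ih]

theorem presink_computes : presink.Computes fun x _ => min (x ()) 1 := by
  refine computes_of_length (f := fun m => min m 1) fun w b => ?_
  cases w with
  | nil => rfl
  | cons i w =>
    change 1 + presink.outWord w true b = min (w.length + 1) 1
    rw [presink_outWord_true]
    omega

end Gate

/-! ### Renaming letters -/

namespace AbelianProcessor

variable {A B Q A' B' Q' A'' B'' Q'' : Type*}

/-- The processor `P` with its letters renamed by the bijections `α` and `β`. -/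
def rename (P : AbelianProcessor A B Q) (α : A ≃ A') (β : B ≃ B') : AbelianProcessor A' B' Q where
  trans := fun a q => P.trans (α.symm a) q
  out := fun a q b => P.out (α.symm a) q (β.symm b)
  start := P.start
  trans_comm := fun _ _ q => P.trans_comm _ _ q
  out_comm := fun i j q => funext fun b =>
    congrFun (P.out_comm (α.symm i) (α.symm j) q) (β.symm b)
  accessible := fun q => by
    obtain ⟨w, rfl⟩ := P.accessible q
    refine ⟨w.map α, ?_⟩
    generalize P.start = s
    induction w generalizing s with
    | nil => rfl
    | cons i w ih => simp [Processor.transWord, ih]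

theorem rename_isomorphic (P : AbelianProcessor A B Q) (α : A ≃ A') (β : B ≃ B') :
    (P.rename α β).Isomorphic P :=
  ⟨α.symm, β.symm, Equiv.refl _, rfl, fun _ _ => ⟨rfl, fun _ => rfl⟩⟩

theorem Isomorphic.refl (P : AbelianProcessor A B Q) : P.Isomorphic P :=
  ⟨Equiv.refl _, Equiv.refl _, Equiv.refl _, rfl, fun _ _ => ⟨rfl, fun _ => rfl⟩⟩

theorem Isomorphic.trans {P : AbelianProcessor A B Q} {P' : AbelianProcessor A' B' Q'}
    {P'' : AbelianProcessor A'' B'' Q''} (h : P.Isomorphic P') (h' : P'.Isomorphic P'') :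
    P.Isomorphic P'' := by
  obtain ⟨α, β, σ, hs, h⟩ := h
  obtain ⟨α', β', σ', hs', h'⟩ := h'
  refine ⟨α.trans α', β.trans β', σ.trans σ', by simp [hs, hs'], fun a q => ⟨?_, fun b => ?_⟩⟩
  · simp [(h a q).1, (h' _ _).1]
  · simp [(h a q).2, (h' _ _).2]

theorem IsLogicGate.rename {P : AbelianProcessor A B Q} (h : P.IsLogicGate) (α : A ≃ A')
    (β : B ≃ B') : (P.rename α β).IsLogicGate := by
  have hP := P.rename_isomorphic α β
  rcases h with h | h | ⟨n, hn, q, h⟩ | h | h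
  · exact Or.inl (hP.trans h)
  · exact Or.inr (Or.inl (hP.trans h))
  · exact Or.inr (Or.inr (Or.inl ⟨n, hn, q, hP.trans h⟩))
  · exact Or.inr (Or.inr (Or.inr (Or.inl (hP.trans h))))
  · exact Or.inr (Or.inr (Or.inr (Or.inr (hP.trans h))))

theorem rename_outWord (P : AbelianProcessor A B Q) (α : A ≃ A') (β : B ≃ B') (w : List A) (q : Q)
    (b : B') : (P.rename α β).outWord (w.map α) q b = P.outWord w q (β.symm b) := by
  induction w generalizing q with
  | nil => rfl
  | cons i w ih =>
    change P.out (α.symm (α i)) q (β.symm b) +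
      (P.rename α β).outWord (w.map α) (P.trans (α.symm (α i)) q) b = _
    rw [ih, Equiv.symm_apply_apply]
    rfl

end AbelianProcessor

namespace Gate

open AbelianProcessor

theorem adder_isLogicGate : adder.IsLogicGate := Or.inl (Isomorphic.refl _)

theorem splitter_isLogicGate : splitter.IsLogicGate := Or.inr (Or.inl (Isomorphic.refl _))

theorem toppler_isLogicGate (n : ℕ) (hn : 2 ≤ n) (q : Fin n) : (toppler n hn q).IsLogicGate :=
  Or.inr (Or.inr (Or.inl ⟨n, hn, q, Isomorphic.refl _⟩))

theorem delayer_isLogicGate : delayer.IsLogicGate :=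
  Or.inr (Or.inr (Or.inr (Or.inl (Isomorphic.refl _))))

theorem presink_isLogicGate : presink.IsLogicGate :=
  Or.inr (Or.inr (Or.inr (Or.inr (Isomorphic.refl _))))

end Gate

namespace AbelianNetwork

variable {A : Type*}

/-! ### Copying the inputs -/

/-- The network with one splitter per input; of its two outgoing edges one is an output edge and
the other one is a trash edge. The inputs are indexed by a type `K` in the lowest universe. -/
noncomputable def copyInputs {K : Type} [Finite K] (σ : A ≃ K) : AbelianNetwork A K where
  V := K
  E := K ⊕ K × Fin 2
  finite_V := inferInstance
  finite_E := inferInstance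
  tail := Sum.elim (fun _ => none) fun d => some d.1
  head := Sum.elim some fun _ => none
  input := σ.toEmbedding.trans Function.Embedding.inl
  output := ⟨fun k => Sum.inr (k, 0), fun k l h => by simpa using h⟩
  trash := Set.range fun k => Sum.inr (k, 1)
  disjoint_input_output := by simp [Set.disjoint_left]
  disjoint_input_trash := by simp [Set.disjoint_left]
  disjoint_output_trash := by
    refine Set.disjoint_left.2 ?_
    rintro _ ⟨k, rfl⟩ ⟨l, h⟩
    cases h
  tail_eq_none_iff := by
    rintro (k | ⟨k, i⟩)
    · simpa using ⟨σ.symm k, by simp⟩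
    · simp
  head_eq_none_iff := by
    rintro (k | ⟨k, i⟩)
    · simp
    · refine ⟨fun _ => ?_, fun _ => rfl⟩
      fin_cases i
      · exact Or.inl ⟨k, rfl⟩
      · exact Or.inr ⟨k, rfl⟩
  State := fun _ => Unit
  finite_State := fun _ => inferInstance
  proc := fun k => Gate.splitter.rename
    (Equiv.ofBijective (fun _ : Unit => ⟨Sum.inl k, rfl⟩)
      ⟨fun _ _ _ => rfl, by
        rintro ⟨l | d, h⟩
        · exact ⟨(), Subtype.ext (congrArg Sum.inl (Option.some_injective _ h).symm)⟩
        · cases h⟩)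
    (Equiv.ofBijective (fun i : Fin 2 => ⟨Sum.inr (k, i), rfl⟩)
      ⟨fun i j h => congrArg Prod.snd (Sum.inr_injective (Subtype.ext_iff.1 h)), by
        rintro ⟨l | ⟨l, i⟩, h⟩
        · cases h
        · exact ⟨i, Subtype.ext (congrArg (fun m => Sum.inr (m, i))
            (Option.some_injective _ h).symm)⟩⟩)

theorem realizes_copyInputs {K : Type} [Finite K] (σ : A ≃ K) :
    (copyInputs σ).Realizes fun k x => x (σ.symm k) where
  gates := fun _ => Gate.splitter_isLogicGate.rename _ _
  rank := ⟨fun _ => 0, by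
    rintro u v ⟨k | d, h₁, h₂⟩
    · cases h₁
    · cases h₂⟩
  val := fun x => by
    classical
    refine ⟨Sum.elim (fun k => x (σ.symm k)) fun d => x (σ.symm d.1), ?_, ?_, fun _ => rfl⟩
    · intro a
      exact congrArg x (σ.symm_apply_apply a)
    · intro k
      refine ⟨List.replicate (x (σ.symm k)) ⟨Sum.inl k, rfl⟩, ?_, ?_⟩
      · rintro ⟨l | d, h⟩
        · obtain rfl : l = k := Option.some_injective _ h
          exact List.count_replicate_self
        · cases h
      · rintro ⟨l | ⟨l, i⟩, h⟩
        · cases h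
        · obtain rfl : l = k := Option.some_injective _ h
          have := Gate.splitter_outWord (List.replicate (x (σ.symm l)) ()) i
          rw [List.length_replicate] at this
          refine Eq.trans ?_ this
          rw [← List.map_replicate (f := fun _ : Unit => _) (a := ())]
          refine (AbelianProcessor.rename_outWord _ _ _ _ _ _).trans ?_
          congr 1
          exact (Equiv.symm_apply_eq _).2 rfl

/-! ### Discarding and renaming outputs -/

/-- Rename outputs along `ρ`; the outputs outside of the range of `ρ` become trash edges. -/
def restrict {B B' : Type*} (N : AbelianNetwork A B) (ρ : B' ↪ B) : AbelianNetwork A B' where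
  V := N.V
  E := N.E
  finite_V := N.finite_V
  finite_E := N.finite_E
  tail := N.tail
  head := N.head
  input := N.input
  output := ρ.trans N.output
  trash := N.trash ∪ N.output '' (Set.range ρ)ᶜ
  disjoint_input_output := N.disjoint_input_output.mono_right (by
    rintro _ ⟨b, rfl⟩
    exact ⟨ρ b, rfl⟩)
  disjoint_input_trash := N.disjoint_input_trash.union_right
    (N.disjoint_input_output.mono_right (Set.image_subset_range _ _))
  disjoint_output_trash := by
    refine Set.disjoint_left.2 ?_
    rintro _ ⟨b, rfl⟩ (h | ⟨c, hc, h⟩)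
    · exact Set.disjoint_left.1 N.disjoint_output_trash ⟨ρ b, rfl⟩ h
    · exact hc ⟨b, (N.output.injective h).symm⟩
  tail_eq_none_iff := N.tail_eq_none_iff
  head_eq_none_iff := fun e => by
    rw [N.head_eq_none_iff]
    constructor
    · rintro (⟨b, rfl⟩ | h)
      · by_cases hb : b ∈ Set.range ρ
        · obtain ⟨b, rfl⟩ := hb
          exact Or.inl ⟨b, rfl⟩
        · exact Or.inr (Or.inr ⟨b, hb, rfl⟩)
      · exact Or.inr (Or.inl h)
    · rintro (⟨b, rfl⟩ | h | ⟨b, -, rfl⟩)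
      · exact Or.inl ⟨ρ b, rfl⟩
      · exact Or.inr h
      · exact Or.inl ⟨b, rfl⟩
  State := N.State
  finite_State := N.finite_State
  proc := N.proc

theorem Realizes.restrict {B B' : Type*} {N : AbelianNetwork A B} {g : B → (A → ℕ) → ℕ}
    (h : N.Realizes g) (ρ : B' ↪ B) : (N.restrict ρ).Realizes (g ∘ ρ) where
  gates := h.gates
  rank := h.rank
  val := fun x => by
    obtain ⟨val, h₁, h₂, h₃⟩ := h.val x
    exact ⟨val, h₁, h₂, fun b => h₃ (ρ b)⟩

/-! ### Attaching a processor to outputs -/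

section Attach

variable {R I O S : Type} (N : AbelianNetwork A (R ⊕ I))

/-- The tails in the network `N.attach P`. -/
def attachTail (O : Type) : N.E ⊕ O → Option (Option N.V) :=
  Sum.elim (fun e => (N.tail e).map some) fun _ => some none

open Classical in
/-- The heads in the network `N.attach P`. -/
noncomputable def attachHead (O : Type) : N.E ⊕ O → Option (Option N.V) :=
  Sum.elim (fun e => if ∃ i, N.output (Sum.inr i) = e then some none else (N.head e).map some)
    fun _ => none

theorem attachHead_output_inr (i : I) :
    N.attachHead O (Sum.inl (N.output (Sum.inr i))) = some none := by
  simp [attachHead]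

theorem attachHead_of_head_eq_some {e : N.E} {v : N.V} (h : N.head e = some v) :
    N.attachHead O (Sum.inl e) = some (some v) := by
  have : ¬ ∃ i, N.output (Sum.inr i) = e := by
    rintro ⟨i, rfl⟩
    rw [head_output] at h
    cases h
  simp [attachHead, this, h]

/-- The edges into the new node. -/
noncomputable def attachHeadNone (O : Type) : I ≃ {e // N.attachHead O e = some none} :=
  Equiv.ofBijective (fun i => ⟨Sum.inl (N.output (Sum.inr i)), N.attachHead_output_inr i⟩)
    ⟨fun i j h => by simpa using h, by
      rintro ⟨e | o, h⟩
      · by_cases he : ∃ i, N.output (Sum.inr i) = e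
        · obtain ⟨i, rfl⟩ := he
          exact ⟨i, rfl⟩
        · simp [attachHead, he] at h
      · cases h⟩

/-- The edges into an old node. -/
noncomputable def attachHeadSome (O : Type) (v : N.V) :
    {e // N.head e = some v} ≃ {e // N.attachHead O e = some (some v)} :=
  Equiv.ofBijective (fun e => ⟨Sum.inl e.val, N.attachHead_of_head_eq_some e.2⟩)
    ⟨fun i j h => Subtype.ext (by simpa using h), by
      rintro ⟨e | o, h⟩
      · by_cases he : ∃ i, N.output (Sum.inr i) = e
        · simp [attachHead, he] at h
        · exact ⟨⟨e, by simpa [attachHead, he] using h⟩, rfl⟩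
      · cases h⟩

/-- The edges out of the new node. -/
noncomputable def attachTailNone (O : Type) : O ≃ {e // N.attachTail O e = some none} :=
  Equiv.ofBijective (fun o => ⟨Sum.inr o, rfl⟩)
    ⟨fun i j h => Sum.inr_injective (Subtype.ext_iff.1 h), by
      rintro ⟨e | o, h⟩
      · simp [attachTail] at h
      · exact ⟨o, rfl⟩⟩

/-- The edges out of an old node. -/
noncomputable def attachTailSome (O : Type) (v : N.V) :
    {e // N.tail e = some v} ≃ {e // N.attachTail O e = some (some v)} :=
  Equiv.ofBijective (fun e => ⟨Sum.inl e.val, by simp [attachTail, e.2]⟩)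
    ⟨fun i j h => Subtype.ext (by simpa using h), by
      rintro ⟨e | o, h⟩
      · exact ⟨⟨e, by simpa [attachTail] using h⟩, rfl⟩
      · simp [attachTail] at h⟩

/-- The network `N` with one more node, at which the processor `P` receives the letters from the
outputs of `N` indexed by `I`; the outgoing edges of the node are new output edges. -/
noncomputable def attach [Finite O] [Finite S] (P : AbelianProcessor I O S) :
    AbelianNetwork A (R ⊕ O) where
  V := Option N.V
  E := N.E ⊕ O
  finite_V := by have := N.finite_V; infer_instance
  finite_E := by have := N.finite_E; infer_instance
  tail := N.attachTail O
  head := N.attachHead O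
  input := N.input.trans Function.Embedding.inl
  output := (Function.Embedding.inl.trans N.output).sumMap (Function.Embedding.refl O)
  trash := Sum.inl '' N.trash
  disjoint_input_output := by
    refine Set.disjoint_left.2 ?_
    rintro _ ⟨a, rfl⟩ ⟨r | o, h⟩
    · exact Set.disjoint_left.1 N.disjoint_input_output ⟨a, rfl⟩ ⟨Sum.inl r, Sum.inl_injective h⟩
    · cases h
  disjoint_input_trash := by
    refine Set.disjoint_left.2 ?_
    rintro _ ⟨a, rfl⟩ ⟨e, he, h⟩
    obtain rfl : e = N.input a := Sum.inl_injective h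
    exact Set.disjoint_left.1 N.disjoint_input_trash ⟨a, rfl⟩ he
  disjoint_output_trash := by
    refine Set.disjoint_left.2 ?_
    rintro _ ⟨r | o, rfl⟩ ⟨e, he, h⟩
    · obtain rfl : e = N.output (Sum.inl r) := Sum.inl_injective h
      exact Set.disjoint_left.1 N.disjoint_output_trash ⟨_, rfl⟩ he
    · cases h
  tail_eq_none_iff := by
    rintro (e | o)
    · simp [attachTail, N.tail_eq_none_iff]
    · simp [attachTail]
  head_eq_none_iff := by
    rintro (e | o)
    · by_cases he : ∃ i, N.output (Sum.inr i) = e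
      · obtain ⟨i, rfl⟩ := he
        have := Set.disjoint_left.1 N.disjoint_output_trash ⟨Sum.inr i, rfl⟩
        simp [attachHead, this]
      · simp [attachHead, he, N.head_eq_none_iff]
    · simp [attachHead]
  State := fun v => v.elim S N.State
  finite_State := fun v => match v with
    | none => inferInstanceAs (Finite S)
    | some v => N.finite_State v
  proc := fun v => match v with
    | none => P.rename (N.attachHeadNone O) (N.attachTailNone O)
    | some v => (N.proc v).rename (N.attachHeadSome O v) (N.attachTailSome O v)

variable {N}

theorem Realizes.attach [Finite I] [Finite O] [Finite S] {P : AbelianProcessor I O S}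
    {g : R ⊕ I → (A → ℕ) → ℕ} {G : (I → ℕ) → O → ℕ} (h : N.Realizes g) (hP : P.IsLogicGate)
    (hG : P.Computes G) :
    (N.attach P).Realizes
      (Sum.elim (fun r => g (Sum.inl r)) fun o x => G (fun i => g (Sum.inr i) x) o) where
  gates := fun v => match v with
    | none => hP.rename _ _
    | some v => (h.gates v).rename _ _
  rank := by
    obtain ⟨rank, hrank⟩ := h.rank
    -- The new node is ranked above all old ones.
    have := N.finite_V
    obtain ⟨M, hM⟩ := (Set.finite_range rank).bddAbove
    refine ⟨fun v => v.elim (M + 1) rank, ?_⟩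
    rintro u v ⟨e | o, hu, hv⟩
    · cases hte : N.tail e with
      | none => simp [AbelianNetwork.attach, attachTail, hte] at hu
      | some u' =>
        obtain rfl : u = some u' := by
          simp only [AbelianNetwork.attach, attachTail, hte, Sum.elim_inl, Option.map_some] at hu
          exact (Option.some_injective _ hu).symm
        cases v with
        | none => exact Nat.lt_succ_of_le (hM ⟨u', rfl⟩)
        | some v =>
          refine hrank u' v ⟨e, hte, ?_⟩
          by_cases he : ∃ i, N.output (Sum.inr i) = e
          · simp [AbelianNetwork.attach, attachHead, he] at hv
          · simpa [AbelianNetwork.attach, attachHead, he] using hv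
    · cases hv
  val := fun x => by
    classical
    obtain ⟨val, hin, hval, hout⟩ := h.val x
    have hword : P.outWord (AbelianProcessor.wordOf fun i => g (Sum.inr i) x) P.start =
        G fun i => g (Sum.inr i) x := by
      rw [hG]
      simp only [AbelianProcessor.count_wordOf]
    refine ⟨Sum.elim val fun o => G (fun i => g (Sum.inr i) x) o, hin, ?_, ?_⟩
    · rintro (_ | v)
      · refine ⟨(AbelianProcessor.wordOf fun i => g (Sum.inr i) x).map (N.attachHeadNone O),
          fun e => ?_, fun d => ?_⟩
        · obtain ⟨i, rfl⟩ := (N.attachHeadNone O).surjective e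
          refine (List.count_map_of_injective _ _ (Equiv.injective _) _).trans ?_
          rw [AbelianProcessor.count_wordOf]
          exact (hout (Sum.inr i)).symm
        · obtain ⟨o, rfl⟩ := (N.attachTailNone O).surjective d
          refine (AbelianProcessor.rename_outWord _ _ _ _ _ _).trans ?_
          refine Eq.trans ?_ (congrFun hword o)
          exact congrArg (P.outWord _ P.start) (Equiv.symm_apply_apply _ o)
      · obtain ⟨w, hw, hwout⟩ := hval v
        refine ⟨w.map (N.attachHeadSome O v), fun e => ?_, fun d => ?_⟩
        · obtain ⟨e, rfl⟩ := (N.attachHeadSome O v).surjective e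
          refine (List.count_map_of_injective _ _ (Equiv.injective _) _).trans ?_
          exact hw e
        · obtain ⟨d, rfl⟩ := (N.attachTailSome O v).surjective d
          refine (AbelianProcessor.rename_outWord _ _ _ _ _ _).trans ?_
          refine Eq.trans ?_ (hwout d)
          exact congrArg ((N.proc v).outWord w (N.proc v).start) (Equiv.symm_apply_apply _ d)
    · rintro (r | o)
      · exact hout (Sum.inl r)
      · rfl

end Attach

/-! ### Networks for functions built from gates -/

/-- Some acyclic network of gates realizes the family `g`. -/
def Realizable {K : Type*} (g : K → (A → ℕ) → ℕ) : Prop :=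
  ∃ N : AbelianNetwork A K, N.Realizes g

namespace Realizable

theorem restrict {K L : Type*} {g : K → (A → ℕ) → ℕ} (h : Realizable g) (ρ : L ↪ K)
    {g' : L → (A → ℕ) → ℕ} (hg : ∀ l, g' l = g (ρ l)) : Realizable g' := by
  obtain ⟨N, hN⟩ := h
  obtain rfl : g' = g ∘ ρ := funext hg
  exact ⟨_, hN.restrict ρ⟩

theorem attach {R I O S : Type} [Finite I] [Finite O] [Finite S] {P : AbelianProcessor I O S}
    {g : R ⊕ I → (A → ℕ) → ℕ} {G : (I → ℕ) → O → ℕ} (h : Realizable g) (hP : P.IsLogicGate)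
    (hG : P.Computes G) :
    Realizable
      (Sum.elim (fun r => g (Sum.inl r)) fun o x => G (fun i => g (Sum.inr i) x) o) := by
  obtain ⟨N, hN⟩ := h
  exact ⟨_, hN.attach hP hG⟩

theorem duplicate {K : Type} {g : K → (A → ℕ) → ℕ} (h : Realizable g) (k : K) :
    Realizable (Sum.elim g fun _ : Unit => g k) := by
  classical
  have h₁ : Realizable (Sum.elim (fun l : {l // l ≠ k} => g l.val) fun _ : Unit => g k) :=
    h.restrict ⟨Sum.elim Subtype.val fun _ => k, by
      rintro (⟨l, hl⟩ | _) (⟨m, hm⟩ | _) hlm <;> simp_all [eq_comm (a := k)]⟩ (by rintro (l | _) <;> rfl)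
  refine (h₁.attach Gate.splitter_isLogicGate Gate.splitter_computes).restrict
    ⟨Sum.elim (fun l => if hl : l = k then Sum.inr 0 else Sum.inl ⟨l, hl⟩) fun _ => Sum.inr 1,
      ?_⟩ ?_
  · rintro (l | _) (m | _) hlm
    · by_cases hl : l = k <;> by_cases hm : m = k <;> simp_all
    · by_cases hl : l = k <;> simp_all
    · by_cases hm : m = k <;> simp_all
    · rfl
  · rintro (l | _)
    · by_cases hl : l = k
      · subst hl; simp
      · simp [hl]
    · rfl

/-- Any function built from gates can be added to a realizable family that has all coordinates
among its members. -/
theorem append_gateExpr {f : (A → ℕ) → ℕ} (hf : GateExpr f) :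
    ∀ {K : Type} {g : K → (A → ℕ) → ℕ}, Realizable g → (∀ a, ∃ k, g k = fun x => x a) →
      Realizable (Sum.elim g fun _ : Unit => f) := by
  induction hf with
  | proj a =>
    intro K g h hK
    obtain ⟨k, hk⟩ := hK a
    rw [← hk]
    exact h.duplicate k
  | @add f₁ f₂ _ _ ih₁ ih₂ =>
    intro K g h hK
    have h₁ := ih₂ (ih₁ h hK) fun a => by
      obtain ⟨k, hk⟩ := hK a
      exact ⟨Sum.inl k, hk⟩
    have h₂ : Realizable (Sum.elim g (![f₁, f₂] : Fin 2 → (A → ℕ) → ℕ)) := by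
      refine h₁.restrict ⟨Sum.elim (fun k => Sum.inl (Sum.inl k))
        ![Sum.inl (Sum.inr ()), Sum.inr ()], ?_⟩ ?_
      · rintro (k | i) (l | j) h
        · simpa using h
        · fin_cases j <;> simp at h
        · fin_cases i <;> simp at h
        · fin_cases i <;> fin_cases j <;> simp at h ⊢
      · rintro (k | i)
        · rfl
        · fin_cases i <;> rfl
    exact h₂.attach Gate.adder_isLogicGate Gate.adder_computes
  | toppler n hn q _ ih =>
    intro K g h hK
    exact (ih h hK).attach (Gate.toppler_isLogicGate n hn q) (Gate.toppler_computes n hn q)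
  | delayer _ ih =>
    intro K g h hK
    exact (ih h hK).attach Gate.delayer_isLogicGate Gate.delayer_computes
  | presink _ ih =>
    intro K g h hK
    exact (ih h hK).attach Gate.presink_isLogicGate Gate.presink_computes

theorem append_family {K : Type} {g : K → (A → ℕ) → ℕ} (h : Realizable g)
    (hK : ∀ a, ∃ k, g k = fun x => x a) (L : Type) [Finite L] :
    ∀ f : L → (A → ℕ) → ℕ, (∀ l, GateExpr (f l)) → Realizable (Sum.elim g f) := by
  induction L using Finite.induction_empty_option with
  | of_equiv e ih =>
    intro f hf
    refine (ih (f ∘ e) fun l => hf _).restrict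
      ((Function.Embedding.refl K).sumMap e.symm.toEmbedding) ?_
    rintro (k | l) <;> simp
  | h_empty =>
    intro f _
    refine h.restrict ⟨Sum.elim id PEmpty.elim, ?_⟩ ?_
    · rintro (k | l) (m | l) hkl <;> first | exact l.elim | skip
      exact congrArg Sum.inl hkl
    · rintro (k | l)
      · rfl
      · exact l.elim
  | h_option ih =>
    intro f hf
    refine (append_gateExpr (hf none) (ih (fun l => f (some l)) fun l => hf _) fun a => ?_).restrict
      ⟨Sum.elim (fun k => Sum.inl (Sum.inl k)) fun l =>
        l.elim (Sum.inr ()) fun m => Sum.inl (Sum.inr m), ?_⟩ ?_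
    · obtain ⟨k, hk⟩ := hK a
      exact ⟨Sum.inl k, hk⟩
    · rintro (k | _ | m) (l | _ | m') hkl <;> simp_all
    · rintro (k | _ | m) <;> rfl

/-- Every finite family of functions built from gates is realized by a network. -/
theorem of_gateExpr [Finite A] {B : Type*} [Finite B] (f : B → (A → ℕ) → ℕ)
    (hf : ∀ b, GateExpr (f b)) : Realizable f := by
  obtain ⟨m, ⟨σ⟩⟩ := Finite.exists_equiv_fin A
  obtain ⟨n, ⟨τ⟩⟩ := Finite.exists_equiv_fin B
  have h : Realizable fun (k : Fin m) (x : A → ℕ) => x (σ.symm k) := ⟨_, realizes_copyInputs σ⟩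
  exact (h.append_family (fun a => ⟨σ a, by simp⟩) (Fin n) (fun l => f (τ.symm l))
    fun l => hf _).restrict (τ.toEmbedding.trans Function.Embedding.inr) fun b => by simp

end Realizable

end AbelianNetwork

theorem theoremt {A B Q : Type*} [Finite A] [Nonempty A] [Finite B] [Finite Q]
    (P : AbelianProcessor A B Q) :
    ∃ N : AbelianNetwork A B,
      N.DirectedAcyclic ∧ (∀ v, (N.proc v).IsLogicGate) ∧ N.Emulates P := by
  classical
  obtain ⟨N, hN⟩ := AbelianNetwork.Realizable.of_gateExpr (fun b x => P.eval x b) fun b =>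
    (P.quasiLinear_eval b).gateExpr (congrFun (P.computes_eval []).symm b)
  obtain ⟨rank, hrank⟩ := hN.rank
  exact ⟨N, AbelianNetwork.directedAcyclic_of_rank hrank, hN.gates, P.eval, P.computes_eval,
    hN.computes⟩
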